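/- **Theorem (Properly decomposable functions).** Let $f\colon\mathbb{R}^d\to\mathbb{R}$ be locally Lipschitz and let $\bar x$ be a local minimizer of $f$. Write $\partial f(x)$ for the Clarke subdifferential, i.e. the convex hull of all limits $\lim_i\nabla f(x_i)$ along sequences $x_i\to x$ of points of differentiability of $f$. A function $h\colon\mathbb{R}^m\to\mathbb{R}$ is called sublinear if its epigraph is a closed convex cone, and then $\mathrm{lin}(h)=\{y : h(y)=-h(-y)\}$. Suppose that $f$ is properly $C^4$ decomposable at $\bar x$ as $h\circ c$: there are a $C^4$ map $c\colon\mathbb{R}^d\to\mathbb{R}^m$ with $c(\bar x)=0$ and a sublinear function $h\colon\mathbb{R}^m\to\mathbb{R}$ such that $f(x)=f(\bar x)+h(c(x))$ for all $x$ near $\bar x$ and $$\mathrm{lin}(h)+\mathrm{range}(\nabla c(\bar x))=\mathbb{R}^m .$$ Suppose furthermore that 1. (strict complementarity) $0\in\mathrm{ri}\,\partial f(\bar x)$, where $\mathrm{ri}$ is the relative interior; 2. (quadratic growth) there is $\gamma>0$ with $f(x)-f(\bar x)\ge\frac{\gamma}{2}\|x-\bar x\|^2$ for all $x$ near $\bar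 x$. Then $f$ satisfies the following Assumption A at $\bar x$ with the set $\mathcal{M}:=c^{-1}(\mathrm{lin}(h))$: $f$ is locally Lipschitz with local minimizer $\bar x$, and * (A1) the quadratic growth bound 2 holds; * (A2) $\mathcal{M}$ is an active $C^4$-manifold for $f$ around $\bar x$: $\bar x\in\mathcal{M}$ and $0\in\partial f(\bar x)$; near $\bar x$ the set $\mathcal{M}$ is the zero set of a $C^4$ map into some $\mathbb{R}^k$ with surjective Jacobian; the restriction of $f$ to $\mathcal{M}$ agrees near $\bar x$ with a $C^4$ function defined on a neighborhood of $\bar x$; and there is a neighborhood $U$ of $\bar x$ with $\inf\{\|v\| : v\in\partial f(x),\ x\in U\setminus\mathcal{M}\}>0$ (where $\inf\emptyset=+\infty$); * (A3) there is $C>0$ such that $\|P_{T_{\mathcal{M}}(y)}(v-\nabla_{\mathcal{M}}f(y))\|\le C\|x-y\|$ for all $x$ near $\bar x$, all $v\in\partial f(x)$ and all $y\in\mathcal{M}$ near $\bar x$. Here $T_{\mathcal{M}}(y)$ is the kernel of the Jacobian at $y$ of any local defining map of $\mathcal{M}$ around $y$, $P_{T}$ is the orthogonal projection onto $T$, and $\nabla_{\mathcal{M}}f(y)=P_{T_{\mathcal{M}}(y)}(\nabla\hat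 f(y))$ for any smooth function $\hat f$ that is defined on a neighborhood of $y$ and agrees there with $f$ on $\mathcal{M}$; * (A4) there is a function $o\colon\mathbb{R}\to\mathbb{R}$ with $\lim_{t\to0}o(t)/t=0$ such that $f(y)\ge f(x)+\langle v,y-x\rangle+o(\|y-x\|)$ for all $x$ near $\bar x$, all $v\in\partial f(x)$ and all $y\in\mathcal{M}$ near $\bar x$. -/

import Mathlib

open Set Filter Topology

namespace NonsmoothOpt

/-- `ℝ^d` with its Euclidean norm and inner product. -/
abbrev Euc (d : ℕ) := EuclideanSpace ℝ (Fin d)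

/-! ### Subdifferential and growth -/

/-- The Clarke subdifferential of `f` at `x` : the convex hull of all limits of gradients
`∇ f (x_i)` along sequences of differentiability points `x_i → x`. -/
def clarkeSubdifferential {d : ℕ} (f : Euc d → ℝ) (x : Euc d) : Set (Euc d) :=
  convexHull ℝ {v | ∃ u : ℕ → Euc d, (∀ i, DifferentiableAt ℝ f (u i)) ∧
    Tendsto u atTop (𝓝 x) ∧ Tendsto (fun i => gradient f (u i)) atTop (𝓝 v)}

/-- Quadratic growth of `f` at `xbar`. -/
def QuadraticGrowth {d : ℕ} (f : Euc d → ℝ) (xbar : Euc d) : Prop :=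
  ∃ γ : ℝ, 0 < γ ∧ ∀ᶠ x in 𝓝 xbar, γ / 2 * ‖x - xbar‖ ^ 2 ≤ f x - f xbar

/-- Strict complementarity: `0` lies in the relative interior of the Clarke subdifferential. -/
def StrictComplementarity {d : ℕ} (f : Euc d → ℝ) (xbar : Euc d) : Prop :=
  (0 : Euc d) ∈ intrinsicInterior ℝ (clarkeSubdifferential f xbar)

/-! ### Sublinear functions and proper decomposability -/

/-- The epigraph of a real-valued function. -/
def epigraph {m : ℕ} (h : Euc m → ℝ) : Set (Euc m × ℝ) := {z | h z.1 ≤ z.2}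

/-- `h` is sublinear: its epigraph is a closed convex cone. -/
structure IsSublinear {m : ℕ} (h : Euc m → ℝ) : Prop where
  isClosed : IsClosed (epigraph h)
  convex : Convex ℝ (epigraph h)
  cone : ∀ r : ℝ, 0 < r → ∀ z ∈ epigraph h, r • z ∈ epigraph h

/-- The lineality space of `h`. -/
def lineality {m : ℕ} (h : Euc m → ℝ) : Set (Euc m) := {y | h y = -h (-y)}

open scoped Pointwise in
/-- `f` is properly `C^p` decomposable at `xbar` as `h ∘ c`. (Properness of `h` is automatic, as
`h` is real-valued; closedness is part of `IsSublinear`.) -/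
structure IsProperlyDecomposableAs {d m : ℕ} (p : ℕ) (f : Euc d → ℝ) (xbar : Euc d)
    (h : Euc m → ℝ) (c : Euc d → Euc m) : Prop where
  smooth : ContDiff ℝ p c
  map_base : c xbar = 0
  sublinear : IsSublinear h
  decomp : ∀ᶠ x in 𝓝 xbar, f x = f xbar + h (c x)
  transversality : lineality h + Set.range (fderiv ℝ c xbar) = Set.univ

/-! ### Manifolds, tangent spaces, covariant gradients -/

/-- `F` is a `C^p` map on the open neighbourhood `U` of `x`, with surjective Jacobian, whose zero
set is `M ∩ U`. -/
structure IsDefiningMap {d k : ℕ} (p : ℕ) (M : Set (Euc d)) (x : Euc d) (U : Set (Euc d))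
    (F : Euc d → Euc k) : Prop where
  isOpen : IsOpen U
  mem : x ∈ U
  smooth : ContDiffOn ℝ p F U
  surjective : ∀ z ∈ U, Function.Surjective (fderiv ℝ F z)
  zero_set : M ∩ U = {z ∈ U | F z = 0}

/-- `M` is a `C^p`-smooth manifold around `x`. -/
def IsManifoldAround {d : ℕ} (p : ℕ) (M : Set (Euc d)) (x : Euc d) : Prop :=
  ∃ (k : ℕ) (U : Set (Euc d)) (F : Euc d → Euc k), IsDefiningMap p M x U F

open scoped Classical in
/-- The tangent space `T_M(y) = ker ∇F(y)`, where `F` is any local defining map of `M` around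
`y ∈ M` (see `tangentSpace_eq` for the independence of the choice). -/
noncomputable def tangentSpace {d : ℕ} (M : Set (Euc d)) (y : Euc d) : Submodule ℝ (Euc d) :=
  if hM : IsManifoldAround 1 M y then
    LinearMap.ker (fderiv ℝ hM.choose_spec.choose_spec.choose y).toLinearMap
  else ⊥

/-- `fhat` is a `C^q` function on the open neighbourhood `U` of `x` which agrees with `f` on
`U ∩ M`. -/
structure IsSmoothExtension {d : ℕ} (q : ℕ) (f : Euc d → ℝ) (M : Set (Euc d)) (x : Euc d)
    (U : Set (Euc d)) (fhat : Euc d → ℝ) : Prop where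
  isOpen : IsOpen U
  mem : x ∈ U
  smooth : ContDiffOn ℝ q fhat U
  agree : ∀ z ∈ U ∩ M, fhat z = f z

/-- The restriction of `f` to `M` is `C^q`-smooth around `x`. -/
def IsSmoothAlong {d : ℕ} (q : ℕ) (f : Euc d → ℝ) (M : Set (Euc d)) (x : Euc d) : Prop :=
  ∃ (U : Set (Euc d)) (fhat : Euc d → ℝ), IsSmoothExtension q f M x U fhat

open scoped Classical in
/-- The covariant gradient `∇_M f(y) = P_{T_M(y)} (∇ fhat(y))`, where `fhat` is any smooth local
extension of `f|_M` around `y ∈ M` (see `covariantGradient_eq` for the independence of the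
choice). -/
noncomputable def covariantGradient {d : ℕ} (f : Euc d → ℝ) (M : Set (Euc d)) (y : Euc d) :
    Euc d :=
  if hf : IsSmoothAlong 1 f M y then
    (tangentSpace M y).starProjection (gradient hf.choose_spec.choose y)
  else 0

/-- A `C^1` function which vanishes on `M` near `y ∈ M` has zero derivative on `ker ∇F(y)`. -/
theorem fderiv_eq_zero_of_vanish {d k : ℕ} {M : Set (Euc d)} {y : Euc d} {U V : Set (Euc d)}
    {F : Euc d → Euc k} (hF : IsDefiningMap 1 M y U F) (hy : y ∈ M) (hV : IsOpen V) (hyV : y ∈ V)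
    {φ : Euc d → ℝ} (hφ : ContDiffOn ℝ 1 φ V) (h0 : ∀ z ∈ V ∩ M, φ z = 0)
    {v : Euc d} (hv : fderiv ℝ F y v = 0) : fderiv ℝ φ y v = 0 := by
  have hFy : F y = 0 := by
    have : y ∈ {z ∈ U | F z = 0} := hF.zero_set ▸ ⟨hy, hF.mem⟩
    exact this.2
  have hFs : HasStrictFDerivAt F (fderiv ℝ F y) y :=
    (hF.smooth.contDiffAt (hF.isOpen.mem_nhds hF.mem)).hasStrictFDerivAt (by norm_num)
  have hφs : HasStrictFDerivAt φ (fderiv ℝ φ y) y :=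
    (hφ.contDiffAt (hV.mem_nhds hyV)).hasStrictFDerivAt (by norm_num)
  have hext : IsLocalExtrOn φ {x | F x = F y} y := by
    left
    have hUV : U ∩ V ∈ 𝓝 y := (hF.isOpen.inter hV).mem_nhds ⟨hF.mem, hyV⟩
    filter_upwards [mem_nhdsWithin_of_mem_nhds hUV, self_mem_nhdsWithin] with z hz hz2
    have hzM : z ∈ M ∩ U := by
      rw [hF.zero_set]
      exact ⟨hz.1, by simpa [hFy] using hz2⟩
    rw [h0 y ⟨hyV, hy⟩, h0 z ⟨hz.2, hzM.1⟩]
  obtain ⟨Λ, Λ₀, hne, hΛ⟩ := hext.exists_linear_map_of_hasStrictFDerivAt hFs hφs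
  by_contra hcon
  have h1 := hΛ v
  rw [hv, map_zero, zero_add, smul_eq_mul] at h1
  have hΛ₀ : Λ₀ = 0 := (mul_eq_zero.mp h1).resolve_right hcon
  apply hne
  have hΛ0 : Λ = 0 := by
    ext1 w
    obtain ⟨x, rfl⟩ := hF.surjective y hF.mem w
    have := hΛ x
    simpa [hΛ₀] using this
  rw [hΛ0, hΛ₀]
  rfl

theorem ker_le_ker {d k l : ℕ} {M : Set (Euc d)} {y : Euc d} {U V : Set (Euc d)}
    {F : Euc d → Euc k} {G : Euc d → Euc l} (hF : IsDefiningMap 1 M y U F)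
    (hG : IsDefiningMap 1 M y V G) (hy : y ∈ M) :
    LinearMap.ker (fderiv ℝ F y).toLinearMap ≤ LinearMap.ker (fderiv ℝ G y).toLinearMap := by
  intro v hv
  have hv' : fderiv ℝ F y v = 0 := hv
  have hGd : DifferentiableAt ℝ G y :=
    (hG.smooth.contDiffAt (hG.isOpen.mem_nhds hG.mem)).differentiableAt (by norm_num)
  change fderiv ℝ G y v = 0
  ext i
  have hz : ∀ z ∈ V ∩ M, (EuclideanSpace.proj i : Euc l →L[ℝ] ℝ) (G z) = 0 := by
    intro z hz
    have : z ∈ {z ∈ V | G z = 0} := hG.zero_set ▸ ⟨hz.2, hz.1⟩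
    rw [this.2, map_zero]
  have h := fderiv_eq_zero_of_vanish hF hy hG.isOpen hG.mem
    (φ := fun z => (EuclideanSpace.proj i : Euc l →L[ℝ] ℝ) (G z))
    ((EuclideanSpace.proj i : Euc l →L[ℝ] ℝ).contDiff.comp_contDiffOn hG.smooth) hz hv'
  have hd : HasFDerivAt (fun z => (EuclideanSpace.proj i : Euc l →L[ℝ] ℝ) (G z))
      ((EuclideanSpace.proj i : Euc l →L[ℝ] ℝ).comp (fderiv ℝ G y)) y :=
    (EuclideanSpace.proj i : Euc l →L[ℝ] ℝ).hasFDerivAt.comp y hGd.hasFDerivAt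
  rw [hd.fderiv] at h
  simpa using h

/-- The tangent space does not depend on the defining map. -/
theorem tangentSpace_eq {d k : ℕ} {M : Set (Euc d)} {y : Euc d} {U : Set (Euc d)}
    {F : Euc d → Euc k} (hF : IsDefiningMap 1 M y U F) (hy : y ∈ M) :
    tangentSpace M y = LinearMap.ker (fderiv ℝ F y).toLinearMap := by
  have hM : IsManifoldAround 1 M y := ⟨k, U, F, hF⟩
  rw [tangentSpace, dif_pos hM]
  have hG := hM.choose_spec.choose_spec.choose_spec
  exact le_antisymm (ker_le_ker hG hF hy) (ker_le_ker hF hG hy)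

/-- The covariant gradient does not depend on the smooth extension. -/
theorem covariantGradient_eq {d : ℕ} {f : Euc d → ℝ} {M : Set (Euc d)} {y : Euc d}
    (hM : IsManifoldAround 1 M y) (hy : y ∈ M) {U : Set (Euc d)} {fhat : Euc d → ℝ}
    (hf : IsSmoothExtension 1 f M y U fhat) :
    covariantGradient f M y = (tangentSpace M y).starProjection (gradient fhat y) := by
  have hS : IsSmoothAlong 1 f M y := ⟨U, fhat, hf⟩
  rw [covariantGradient, dif_pos hS]
  obtain ⟨k, V, F, hF⟩ := hM
  have hg := hS.choose_spec.choose_spec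
  set W := hS.choose
  set g := hS.choose_spec.choose
  have hgd : DifferentiableAt ℝ g y :=
    (hg.smooth.contDiffAt (hg.isOpen.mem_nhds hg.mem)).differentiableAt (by norm_num)
  have hfd : DifferentiableAt ℝ fhat y :=
    (hf.smooth.contDiffAt (hf.isOpen.mem_nhds hf.mem)).differentiableAt (by norm_num)
  rw [← sub_eq_zero, ← map_sub, Submodule.starProjection_apply_eq_zero_iff,
    Submodule.mem_orthogonal]
  intro v hv
  rw [tangentSpace_eq hF hy] at hv
  have h := fderiv_eq_zero_of_vanish hF hy (hg.isOpen.inter hf.isOpen) ⟨hg.mem, hf.mem⟩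
    (φ := fun z => g z - fhat z)
    ((hg.smooth.mono inter_subset_left).sub (hf.smooth.mono inter_subset_right))
    (fun z hz => by rw [hg.agree z ⟨hz.1.1, hz.2⟩, hf.agree z ⟨hz.1.2, hz.2⟩, sub_self]) hv
  rw [fderiv_fun_sub hgd hfd] at h
  rw [real_inner_comm, inner_sub_left]
  simpa [gradient] using h

/-! ### Active manifolds and the regularity assumption -/

/-- `M` is an active `C^p`-manifold for `f` around `xbar`. The sharpness condition says that
`inf {‖v‖ : v ∈ ∂f(x), x ∈ U \ M} > 0`, the infimum of the empty set being `+∞`. -/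
structure IsActiveManifold {d : ℕ} (p : ℕ) (f : Euc d → ℝ) (xbar : Euc d) (M : Set (Euc d)) :
    Prop where
  mem : xbar ∈ M
  critical : (0 : Euc d) ∈ clarkeSubdifferential f xbar
  manifold : IsManifoldAround p M xbar
  smooth : IsSmoothAlong p f M xbar
  sharp : ∃ U ∈ 𝓝 xbar, ∃ μ : ℝ, 0 < μ ∧
    ∀ x ∈ U \ M, ∀ v ∈ clarkeSubdifferential f x, μ ≤ ‖v‖

/-- Strong `(a)`-regularity of `f` along `M` at `xbar`. -/
def StrongA {d : ℕ} (f : Euc d → ℝ) (xbar : Euc d) (M : Set (Euc d)) : Prop :=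
  ∃ C : ℝ, 0 < C ∧ ∃ U ∈ 𝓝 xbar, ∀ x ∈ U, ∀ v ∈ clarkeSubdifferential f x, ∀ y ∈ M ∩ U,
    ‖(tangentSpace M y).starProjection (v - covariantGradient f M y)‖ ≤ C * ‖x - y‖

/-- `(b_≤)`-regularity of `f` along `M` at `xbar`. -/
def BLeRegular {d : ℕ} (f : Euc d → ℝ) (xbar : Euc d) (M : Set (Euc d)) : Prop :=
  ∃ o : ℝ → ℝ, Tendsto (fun t => o t / t) (𝓝[≠] 0) (𝓝 0) ∧
    ∃ U ∈ 𝓝 xbar, ∀ x ∈ U, ∀ v ∈ clarkeSubdifferential f x, ∀ y ∈ M ∩ U,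
      f x + inner ℝ v (y - x) + o ‖y - x‖ ≤ f y

/-- The main structural assumption on `f` at the local minimizer `xbar`, with active manifold
`M`. -/
structure AssumptionA {d : ℕ} (f : Euc d → ℝ) (xbar : Euc d) (M : Set (Euc d)) : Prop where
  locallyLipschitz : LocallyLipschitz f
  isLocalMin : IsLocalMin f xbar
  quadraticGrowth : QuadraticGrowth f xbar
  active : IsActiveManifold 4 f xbar M
  strongA : StrongA f xbar M
  bLeRegular : BLeRegular f xbar M

end NonsmoothOpt

namespace NonsmoothOpt

/-! ### Sublinear functions -/

namespace IsSublinear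

variable {m : ℕ} {h : Euc m → ℝ}

/-! Every Clarke subgradient of `f` at `x` near `xbar` is `∇c(x)ᵀ s`, with `s` a linear minorant of
`h` touching `h` at `c x` (`clarkeSubdifferential_subset`). All minorants agree with `h` on the
lineality space `L`, and their norms are bounded by one constant `K`. This gives the regularity
conditions: (A4) is the minorant inequality plus Taylor's formula for `c`, and for (A3) tangent
vectors are sent into `L`, where minorants agree, so only the variation of `∇c` remains. Along `M`
the function is `f xbar + ⟨s, c⟩` for any fixed minorant `s`. With `Q` linear, onto and of kernel
`L`, transversality makes `Q ∘ c` a defining map of `M`.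

Sharpness is where strict complementarity enters. Let `A = ∇c(xbar)` and suppose `h (A w) ≤ 0`. Then
every subgradient at `xbar` is nonpositive on `w`, hence vanishes on it. By transversality each
gradient of `h` yields such a subgradient, so all gradients of `h` are orthogonal to `A w`, which
forces `A w ∈ L`. With `s₀` a minorant such that `Aᵀ s₀ = 0`, compactness then gives `ε ‖Q y‖ ≤ h y
- ⟨s₀, y⟩`. Off `M`, a minorant active at `c x` therefore stays away from `s₀` modulo
`Lᗮ`-coordinates, and a right inverse of `Q ∘ A` transfers this gap to `∇c(x)ᵀ s`. -/

theorem map_smul_le (hh : IsSublinear h) {r : ℝ} (hr : 0 < r) (y : Euc m) :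
    h (r • y) ≤ r * h y :=
  hh.cone r hr (y, h y) (le_refl (h y))

theorem map_smul (hh : IsSublinear h) {r : ℝ} (hr : 0 < r) (y : Euc m) :
    h (r • y) = r * h y := by
  refine le_antisymm (hh.map_smul_le hr y) ?_
  have := hh.map_smul_le (inv_pos.2 hr) (r • y)
  rw [inv_smul_smul₀ hr.ne'] at this
  rwa [le_inv_mul_iff₀ hr] at this

theorem map_zero (hh : IsSublinear h) : h 0 = 0 := by
  have := hh.map_smul (r := 2) (by norm_num) 0
  rw [smul_zero] at this
  linarith

theorem map_smul_of_nonneg (hh : IsSublinear h) {r : ℝ} (hr : 0 ≤ r) (y : Euc m) :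
    h (r • y) = r * h y := by
  rcases hr.eq_or_lt with rfl | hr
  · simp [hh.map_zero]
  · exact hh.map_smul hr y

theorem map_add_le (hh : IsSublinear h) (y z : Euc m) : h (y + z) ≤ h y + h z := by
  have h1 : ((1 / 2 : ℝ) • y + (1 / 2 : ℝ) • z, (1 / 2 : ℝ) * h y + (1 / 2 : ℝ) * h z)
      ∈ epigraph h :=
    hh.convex (x := (y, h y)) (le_refl (h y)) (y := (z, h z)) (le_refl (h z))
      (by norm_num) (by norm_num) (by norm_num)
  have h2 : h ((1 / 2 : ℝ) • y + (1 / 2 : ℝ) • z) ≤ (1 / 2 : ℝ) * h y + (1 / 2 : ℝ) * h z := h1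
  rw [← smul_add, hh.map_smul (by norm_num)] at h2
  linarith

theorem neg_map_neg_le (hh : IsSublinear h) (y : Euc m) : -h (-y) ≤ h y := by
  have := hh.map_add_le y (-y)
  rw [add_neg_cancel, hh.map_zero] at this
  linarith

theorem convexOn (hh : IsSublinear h) : ConvexOn ℝ univ h := by
  refine ⟨convex_univ, fun x _ y _ a b ha hb _ => ?_⟩
  have := hh.map_add_le (a • x) (b • y)
  rwa [hh.map_smul_of_nonneg ha, hh.map_smul_of_nonneg hb] at this

theorem continuous (hh : IsSublinear h) : Continuous h :=
  continuousOn_univ.1 (hh.convexOn.continuousOn isOpen_univ)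

/-- This `K` serves both as a Lipschitz constant of `h` and as a bound on the norms of all its
linear minorants. -/
theorem exists_le_norm (hh : IsSublinear h) : ∃ K : NNReal, ∀ y, h y ≤ K * ‖y‖ := by
  obtain ⟨K, hK⟩ := (isCompact_sphere (0 : Euc m) 1).exists_bound_of_continuousOn
    hh.continuous.continuousOn
  refine ⟨K.toNNReal, fun y => ?_⟩
  rcases eq_or_ne y 0 with rfl | hy
  · simp [hh.map_zero]
  have hy0 : 0 < ‖y‖ := norm_pos_iff.2 hy
  have h1 := hK (‖y‖⁻¹ • y) (by simp [norm_smul, hy0.ne'])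
  have h2 := hh.map_smul hy0 (‖y‖⁻¹ • y)
  rw [smul_inv_smul₀ hy0.ne'] at h2
  rw [h2, mul_comm]
  exact mul_le_mul_of_nonneg_right
    ((le_abs_self _).trans (h1.trans (Real.le_coe_toNNReal K))) hy0.le

theorem lipschitzWith (hh : IsSublinear h) {K : NNReal} (hK : ∀ y, h y ≤ K * ‖y‖) :
    LipschitzWith K h := by
  refine LipschitzWith.of_le_add_mul K fun x y => ?_
  have := hh.map_add_le y (x - y)
  rw [add_sub_cancel] at this
  rw [dist_eq_norm]
  linarith [hK (x - y)]

/-- Translations along the lineality space act additively. -/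
theorem map_add_of_mem_lineality (hh : IsSublinear h) (y : Euc m) {l : Euc m}
    (hl : l ∈ lineality h) : h (y + l) = h y + h l := by
  refine le_antisymm (hh.map_add_le y l) ?_
  have h1 := hh.map_add_le (y + l) (-l)
  rw [add_neg_cancel_right] at h1
  have h2 : h l = -h (-l) := hl
  linarith

/-- The lineality space as a linear subspace. -/
def linealitySubmodule (hh : IsSublinear h) : Submodule ℝ (Euc m) where
  carrier := lineality h
  zero_mem' := by simp [lineality, hh.map_zero]
  add_mem' := by
    intro a b ha hb
    have h1 := hh.map_add_of_mem_lineality a hb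
    have h2 := hh.map_add_le (-a) (-b)
    have h3 := hh.neg_map_neg_le (a + b)
    have ha' : h a = -h (-a) := ha
    have hb' : h b = -h (-b) := hb
    rw [← neg_add] at h2
    change h (a + b) = -h (-(a + b))
    linarith
  smul_mem' := by
    intro r a ha
    have ha' : h a = -h (-a) := ha
    change h (r • a) = -h (-(r • a))
    rcases le_total 0 r with hr | hr
    · rw [← smul_neg, hh.map_smul_of_nonneg hr, hh.map_smul_of_nonneg hr, ha']
      ring
    · have hr' : 0 ≤ -r := neg_nonneg.2 hr
      rw [← neg_smul, hh.map_smul_of_nonneg hr', ← neg_smul_neg, hh.map_smul_of_nonneg hr', ha']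
      ring

/-- A surjective linear map onto some `ℝ^k` whose kernel is the lineality space. -/
theorem exists_ker_eq_lineality (hh : IsSublinear h) :
    ∃ (k : ℕ) (Q : Euc m →L[ℝ] Euc k), Function.Surjective Q ∧
      ∀ y, Q y = 0 ↔ y ∈ lineality h := by
  set L := hh.linealitySubmodule
  refine ⟨_, (stdOrthonormalBasis ℝ Lᗮ).repr.toContinuousLinearEquiv.toContinuousLinearMap ∘L
    Lᗮ.orthogonalProjectionOnto, ?_, fun y => ?_⟩
  · refine (stdOrthonormalBasis ℝ Lᗮ).repr.surjective.comp fun z => ⟨z, ?_⟩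
    exact Submodule.orthogonalProjectionOnto_mem_subspace_eq_self z
  · have h1 : y ∈ lineality h ↔ y ∈ L := Iff.rfl
    rw [h1]
    simp

end IsSublinear

/-- The subgradients at the origin of a sublinear function `h`, i.e. the linear minorants. -/
def linearMinorants {m : ℕ} (h : Euc m → ℝ) : Set (Euc m) := {s | ∀ y, inner ℝ s y ≤ h y}

/-- The subgradients of a sublinear function `h` at `x`. -/
def sublinearSubdifferential {m : ℕ} (h : Euc m → ℝ) (x : Euc m) : Set (Euc m) :=
  {s ∈ linearMinorants h | inner ℝ s x = h x}

/-! ### Linear minorants and subgradients of a sublinear function. -/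

section Minorants

variable {m : ℕ} {h : Euc m → ℝ}

/-- Testing at `l` and `-l` squeezes the value. Hence two minorants differ by a vector orthogonal to
the lineality space. -/
theorem inner_eq_of_mem_lineality {s : Euc m} (hs : s ∈ linearMinorants h) {l : Euc m}
    (hl : l ∈ lineality h) : inner ℝ s l = h l := by
  refine le_antisymm (hs l) ?_
  have h1 := hs (-l)
  rw [inner_neg_right] at h1
  have h2 : h l = -h (-l) := hl
  linarith

theorem norm_le_of_mem_linearMinorants {s : Euc m} (hs : s ∈ linearMinorants h) {K : NNReal}
    (hK : ∀ y, h y ≤ K * ‖y‖) : ‖s‖ ≤ K := by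
  have h1 := (hs s).trans (hK s)
  rw [real_inner_self_eq_norm_sq, sq] at h1
  rcases (norm_nonneg s).eq_or_lt with h0 | h0
  · rw [← h0]
    exact K.2
  · exact le_of_mul_le_mul_right h1 h0

theorem isClosed_linearMinorants : IsClosed (linearMinorants h) := by
  simp only [linearMinorants, Set.ofPred_forall]
  exact isClosed_iInter fun y =>
    isClosed_le (continuous_id.inner continuous_const) continuous_const

theorem convex_sublinearSubdifferential (x : Euc m) : Convex ℝ (sublinearSubdifferential h x) := by
  rintro s ⟨hs, hsx⟩ t ⟨ht, htx⟩ a b ha hb hab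
  refine ⟨fun y => ?_, ?_⟩
  · rw [inner_add_left, real_inner_smul_left, real_inner_smul_left]
    calc a * inner ℝ s y + b * inner ℝ t y ≤ a * h y + b * h y :=
          add_le_add (mul_le_mul_of_nonneg_left (hs y) ha) (mul_le_mul_of_nonneg_left (ht y) hb)
      _ = h y := by rw [← add_mul, hab, one_mul]
  · rw [inner_add_left, real_inner_smul_left, real_inner_smul_left, hsx, htx, ← add_mul, hab,
      one_mul]

/-- Hahn–Banach: a linear functional dominated by `h ∘ T` is the pullback of a linear minorant
of `h`. -/
theorem IsSublinear.exists_minorant_of_le_comp (hh : IsSublinear h) {X : Type*} [AddCommGroup X]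
    [Module ℝ X] (T : X →ₗ[ℝ] Euc m) (φ : X →ₗ[ℝ] ℝ) (hφ : ∀ x, φ x ≤ h (T x)) :
    ∃ s ∈ linearMinorants h, ∀ x, inner ℝ s (T x) = φ x := by
  have hker : LinearMap.ker T ≤ LinearMap.ker φ := by
    intro x hx
    have hx' : T x = 0 := hx
    have h1 := hφ x
    have h2 := hφ (-x)
    rw [map_neg, map_neg, hx', neg_zero, hh.map_zero] at h2
    rw [hx', hh.map_zero] at h1
    change φ x = 0
    linarith
  let ψ : LinearMap.range T →ₗ[ℝ] ℝ :=
    ((LinearMap.ker T).liftQ φ hker) ∘ₗ T.quotKerEquivRange.symm.toLinearMap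
  have hψ : ∀ x, ψ ⟨T x, LinearMap.mem_range_self T x⟩ = φ x := by
    intro x
    have : T.quotKerEquivRange.symm ⟨T x, LinearMap.mem_range_self T x⟩
        = (LinearMap.ker T).mkQ x := T.quotKerEquivRange_symm_apply_image x _
    simp [ψ, this]
  obtain ⟨g, hg1, hg2⟩ := exists_extension_of_le_sublinear ⟨LinearMap.range T, ψ⟩ h
    (fun c hc x => hh.map_smul hc x) hh.map_add_le (by
      rintro ⟨_, x, rfl⟩
      exact (hψ x).le.trans (hφ x))
  refine ⟨(InnerProductSpace.toDual ℝ (Euc m)).symm (LinearMap.toContinuousLinearMap g),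
    fun y => ?_, fun x => ?_⟩
  · simpa using hg2 y
  · have := hg1 ⟨T x, LinearMap.mem_range_self T x⟩
    rw [← hψ x]
    simpa using this

/-- The derivative of a sublinear function at a point is a subgradient there. -/
theorem IsSublinear.mem_sublinearSubdifferential_of_hasGradientAt (hh : IsSublinear h)
    {z s : Euc m} (hs : HasGradientAt h s z) : s ∈ sublinearSubdifferential h z := by
  have key : ∀ y, inner ℝ s y ≤ h y := by
    intro y
    refine le_of_tendsto (hs.hasFDerivAt.lim_real y) ?_
    filter_upwards [eventually_gt_atTop 0] with t ht
    have h1 := hh.map_add_le z (t⁻¹ • y)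
    rw [hh.map_smul (inv_pos.2 ht)] at h1
    calc t • (h (z + t⁻¹ • y) - h z) ≤ t * (t⁻¹ * h y) :=
          mul_le_mul_of_nonneg_left (by linarith) ht.le
      _ = h y := by field_simp
  refine ⟨key, le_antisymm (key z) ?_⟩
  -- Along the ray through `z` the function is linear, so the derivative in direction `-z` is `-h
  -- z`; `t > 1` keeps the point on the ray.
  have h2 : inner ℝ s (-z) ≤ -h z := by
    refine le_of_tendsto (hs.hasFDerivAt.lim_real (-z)) ?_
    filter_upwards [eventually_gt_atTop 1] with t ht
    have ht0 : 0 < t := by linarith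
    have h3 : 0 < 1 - t⁻¹ := sub_pos.2 (inv_lt_one_of_one_lt₀ ht)
    have h4 : z + t⁻¹ • -z = (1 - t⁻¹) • z := by module
    rw [h4, hh.map_smul h3, smul_eq_mul]
    refine le_of_eq ?_
    field_simp
    ring
  rw [inner_neg_right] at h2
  linarith

end Minorants

/-! ### Subgradients of composite functions -/

section Composite

variable {d m : ℕ} {f : Euc d → ℝ} {h : Euc m → ℝ} {c : Euc d → Euc m} {a : ℝ}

open ContinuousLinearMap (adjoint)

theorem tendsto_adjoint_fderiv_apply (hc : ContDiff ℝ 1 c) {u : ℕ → Euc d} {x : Euc d}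
    (hu : Tendsto u atTop (𝓝 x)) {s : ℕ → Euc m} {s0 : Euc m} (hs : Tendsto s atTop (𝓝 s0)) :
    Tendsto (fun n => adjoint (fderiv ℝ c (u n)) (s n)) atTop (𝓝 (adjoint (fderiv ℝ c x) s0)) := by
  have h1 : Tendsto (fun n => fderiv ℝ c (u n)) atTop (𝓝 (fderiv ℝ c x)) :=
    ((hc.continuous_fderiv one_ne_zero).tendsto x).comp hu
  have h2 : Tendsto (fun n => adjoint (fderiv ℝ c (u n))) atTop (𝓝 (adjoint (fderiv ℝ c x))) :=
    ((LinearIsometryEquiv.continuous adjoint).tendsto _).comp h1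
  exact (isBoundedBilinearMap_apply.continuous.tendsto _).comp (h2.prodMk_nhds hs)

/-- The gradient of `h ∘ c` at a point of differentiability. -/
theorem exists_gradient_eq_adjoint (hh : IsSublinear h) {u : Euc d}
    (hfc : ∀ᶠ x in 𝓝 u, f x = a + h (c x)) (hf : DifferentiableAt ℝ f u)
    (hc : DifferentiableAt ℝ c u) :
    ∃ s ∈ sublinearSubdifferential h (c u), adjoint (fderiv ℝ c u) s = gradient f u := by
  set B := fderiv ℝ c u
  -- The extra real variable carries the direction `c u`, so that one Hahn–Banach extension yields
  -- both the chain rule and `⟨s, c u⟩ = h (c u)`.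
  let T : (Euc d × ℝ) →ₗ[ℝ] Euc m :=
    B.toLinearMap.coprod (LinearMap.toSpanSingleton ℝ (Euc m) (c u))
  let φ : (Euc d × ℝ) →ₗ[ℝ] ℝ :=
    (fderiv ℝ f u).toLinearMap.coprod (LinearMap.toSpanSingleton ℝ ℝ (h (c u)))
  have hT : ∀ w r, T (w, r) = B w + r • c u := fun w r => by simp [T, B]
  have hφ : ∀ w r, φ (w, r) = fderiv ℝ f u w + r * h (c u) := fun w r => by simp [φ]
  obtain ⟨s, hs, hsT⟩ := hh.exists_minorant_of_le_comp T φ (by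
    rintro ⟨w, r⟩
    rw [hT, hφ, ← le_sub_iff_add_le]
    have h1 := hf.hasFDerivAt.lim_real w
    have h2 : Tendsto (fun t : ℝ => h (t • (c (u + t⁻¹ • w) - c u) + r • c u) - r * h (c u))
        atTop (𝓝 (h (B w + r • c u) - r * h (c u))) :=
      ((hh.continuous.tendsto _).comp
        ((hc.hasFDerivAt.lim_real w).add_const _)).sub_const _
    refine le_of_tendsto_of_tendsto h1 h2 ?_
    have h3 : Tendsto (fun t : ℝ => u + t⁻¹ • w) atTop (𝓝 u) := by
      have h4 : Tendsto (fun t : ℝ => t⁻¹ • w) atTop (𝓝 ((0 : ℝ) • w)) :=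
        tendsto_inv_atTop_zero.smul_const w
      simpa using h4.const_add u
    filter_upwards [h3.eventually hfc, eventually_gt_atTop 0, eventually_ge_atTop r]
      with t ht ht0 htr
    rw [ht, hfc.self_of_nhds]
    -- For `t ≥ r` the coefficient `t - r` is nonnegative, so subadditivity bounds the difference
    -- quotient of `f` by the quantity in `h2`.
    have h4 : t • c (u + t⁻¹ • w) = (t - r) • c u + (t • (c (u + t⁻¹ • w) - c u) + r • c u) := by
      module
    have h5 := hh.map_add_le ((t - r) • c u) (t • (c (u + t⁻¹ • w) - c u) + r • c u)
    rw [← h4, hh.map_smul ht0, hh.map_smul_of_nonneg (sub_nonneg.2 htr)] at h5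
    rw [smul_eq_mul]
    linarith)
  refine ⟨s, ⟨hs, ?_⟩, ?_⟩
  · have := hsT (0, 1)
    rw [hT, hφ] at this
    simpa using this
  · refine ext_inner_right ℝ fun w => ?_
    have := hsT (w, 0)
    rw [hT, hφ] at this
    rw [ContinuousLinearMap.adjoint_inner_left]
    simpa [gradient] using this

/-- The Clarke subdifferential of `h ∘ c` is contained in the one given by the chain rule. -/
theorem clarkeSubdifferential_subset (hh : IsSublinear h) (hc : ContDiff ℝ 1 c) {x : Euc d}
    (hfc : ∀ᶠ z in 𝓝 x, f z = a + h (c z)) :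
    clarkeSubdifferential f x ⊆ adjoint (fderiv ℝ c x) '' sublinearSubdifferential h (c x) := by
  refine convexHull_min ?_ ((convex_sublinearSubdifferential (c x)).is_linear_image
    (adjoint (fderiv ℝ c x)).toLinearMap.isLinear)
  rintro v ⟨u, hud, hux, huv⟩
  obtain ⟨K, hK⟩ := hh.exists_le_norm
  obtain ⟨N, hN⟩ := eventually_atTop.1 (hux.eventually hfc.eventually_nhds)
  have hex : ∀ n, ∃ s ∈ sublinearSubdifferential h (c (u (n + N))),
      adjoint (fderiv ℝ c (u (n + N))) s = gradient f (u (n + N)) := fun n =>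
    exists_gradient_eq_adjoint hh (hN _ (Nat.le_add_left N n)) (hud _)
      (hc.differentiable one_ne_zero _)
  choose s hs hsv using hex
  -- The multipliers lie in the ball of radius `K`; both defining conditions of a subgradient pass
  -- to the limit.
  obtain ⟨s0, -, φ, hφ, hlim⟩ := tendsto_subseq_of_bounded (x := s)
    (Metric.isBounded_closedBall (x := (0 : Euc m)) (r := K))
    fun n => by simpa using norm_le_of_mem_linearMinorants (hs n).1 hK
  have hadd : Tendsto (fun n => φ n + N) atTop atTop :=
    tendsto_atTop_mono (fun n => Nat.le_add_right _ _) hφ.tendsto_atTop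
  have hux' : Tendsto (fun n => u (φ n + N)) atTop (𝓝 x) := hux.comp hadd
  have hcx : Tendsto (fun n => c (u (φ n + N))) atTop (𝓝 (c x)) :=
    (hc.continuous.tendsto x).comp hux'
  refine ⟨s0, ⟨?_, ?_⟩, ?_⟩
  · exact isClosed_linearMinorants.mem_of_tendsto hlim (Eventually.of_forall fun n => (hs _).1)
  · refine tendsto_nhds_unique (hlim.inner hcx) ?_
    have : (fun n => inner ℝ ((s ∘ φ) n) (c (u (φ n + N)))) = fun n => h (c (u (φ n + N))) :=
      funext fun n => (hs (φ n)).2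
    rw [this]
    exact (hh.continuous.tendsto _).comp hcx
  · have h1 : Tendsto (fun n => adjoint (fderiv ℝ c (u (φ n + N))) ((s ∘ φ) n)) atTop
        (𝓝 (adjoint (fderiv ℝ c x) s0)) := tendsto_adjoint_fderiv_apply hc hux' hlim
    refine tendsto_nhds_unique h1 ?_
    have h2 : (fun n => adjoint (fderiv ℝ c (u (φ n + N))) ((s ∘ φ) n))
        = fun n => gradient f (u (φ n + N)) := funext fun n => hsv (φ n)
    rw [h2]
    exact huv.comp hadd

/-- Under transversality, the gradients of `h` give rise to elements of the Clarke
subdifferential of `h ∘ c`. -/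
theorem adjoint_mem_clarkeSubdifferential (hh : IsSublinear h) (hc : ContDiff ℝ 1 c) {x : Euc d}
    (hfc : ∀ᶠ z in 𝓝 x, f z = a + h (c z)) {k : ℕ} {Q : Euc m →L[ℝ] Euc k}
    (hQ : ∀ y, Q y = 0 ↔ y ∈ lineality h) (hcx : c x = 0)
    (hsurj : Function.Surjective (Q ∘L fderiv ℝ c x)) {z s : Euc m} (hs : HasGradientAt h s z) :
    adjoint (fderiv ℝ c x) s ∈ clarkeSubdifferential f x := by
  -- `Q ∘ c` is open at `x`, so arbitrarily close to `x` there are `u` with `c u ∈ t z + L`, `t >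
  -- 0`. At such `c u` the gradient of `h` is again `s`, as it is invariant under positive scaling
  -- and translation by `L`.
  have hmem : x ∈ closure
      {u | (∃ t : ℝ, 0 < t ∧ Q (c u) = t • Q z) ∧ ∀ᶠ y in 𝓝 u, f y = a + h (c y)} := by
    rw [mem_closure_iff_nhds]
    intro V hV
    have hF : HasStrictFDerivAt (fun u => Q (c u)) (Q ∘L fderiv ℝ c x) x :=
      Q.hasStrictFDerivAt.comp x (hc.contDiffAt.hasStrictFDerivAt one_ne_zero)
    have hmap := hF.map_nhds_eq_of_surj (LinearMap.range_eq_top.2 hsurj)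
    have hW : (fun u => Q (c u)) '' (V ∩ {u | ∀ᶠ y in 𝓝 u, f y = a + h (c y)}) ∈ 𝓝 (0 : Euc k) := by
      have := image_mem_map (m := fun u => Q (c u)) (inter_mem hV hfc.eventually_nhds)
      rw [hmap] at this
      simpa [hcx] using this
    have ht : Tendsto (fun t : ℝ => t • Q z) (𝓝[>] 0) (𝓝 0) := by
      have h0 : Tendsto (fun t : ℝ => t • Q z) (𝓝 0) (𝓝 ((0 : ℝ) • Q z)) :=
        tendsto_id.smul_const _
      rw [zero_smul] at h0
      exact h0.mono_left nhdsWithin_le_nhds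
    obtain ⟨t, ⟨u, ⟨huV, huf⟩, hut⟩, ht0⟩ :=
      ((ht.eventually hW).and self_mem_nhdsWithin).exists
    exact ⟨u, huV, ⟨t, ht0, hut⟩, huf⟩
  obtain ⟨u, hu, hux⟩ := mem_closure_iff_seq_limit.1 hmem
  have hgrad : ∀ n, HasGradientAt f (adjoint (fderiv ℝ c (u n)) s) (u n) := by
    intro n
    obtain ⟨⟨t, ht, hQt⟩, hf⟩ := hu n
    have hl : c (u n) - t • z ∈ lineality h := by
      rw [← hQ, map_sub, hQt, map_smul, sub_self]
    have hform : ∀ y, h y = t * h (t⁻¹ • (y - (c (u n) - t • z))) + h (c (u n) - t • z) := by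
      intro y
      rw [← hh.map_smul ht, smul_inv_smul₀ ht.ne', ← hh.map_add_of_mem_lineality _ hl,
        sub_add_cancel]
    have hpt : t⁻¹ • (c (u n) - (c (u n) - t • z)) = z := by
      rw [sub_sub_cancel, inv_smul_smul₀ ht.ne']
    have hcd : HasFDerivAt c (fderiv ℝ c (u n)) (u n) :=
      (hc.differentiable one_ne_zero _).hasFDerivAt
    have hin : HasFDerivAt (fun x => t⁻¹ • (c x - (c (u n) - t • z)))
        (t⁻¹ • fderiv ℝ c (u n)) (u n) := (hcd.sub_const _).fun_const_smul _
    have hs' := hs.hasFDerivAt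
    rw [← hpt] at hs'
    have hcomp := (((hs'.comp (u n) hin).const_mul t).add_const (h (c (u n) - t • z))).const_add a
    have hfd : HasFDerivAt f _ (u n) := hcomp.congr_of_eventuallyEq (by
      filter_upwards [hf] with y hy
      rw [hy, hform (c y)]
      rfl)
    rw [hasGradientAt_iff_hasFDerivAt]
    have hdual : InnerProductSpace.toDual ℝ (Euc d) (adjoint (fderiv ℝ c (u n)) s)
        = t • (InnerProductSpace.toDual ℝ (Euc m) s ∘L (t⁻¹ • fderiv ℝ c (u n))) := by
      ext w
      simp [ContinuousLinearMap.adjoint_inner_left, ht.ne']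
    rw [hdual]
    exact hfd
  refine subset_convexHull ℝ _ ⟨u, fun n => (hgrad n).differentiableAt, hux, ?_⟩
  have : (fun n => gradient f (u n)) = fun n => adjoint (fderiv ℝ c (u n)) s :=
    funext fun n => (hgrad n).gradient
  rw [this]
  exact tendsto_adjoint_fderiv_apply hc hux tendsto_const_nhds

end Composite

/-! ### Consequences of strict complementarity -/

/-- If `0` is a relative interior point of `D`, then a linear functional that is nonpositive on
`D` vanishes on `D`. -/
theorem inner_eq_zero_of_zero_mem_intrinsicInterior {E : Type*} [NormedAddCommGroup E]
    [InnerProductSpace ℝ E] {D : Set E} (h0 : (0 : E) ∈ intrinsicInterior ℝ D) {w : E}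
    (hw : ∀ v ∈ D, inner ℝ v w ≤ 0) {v : E} (hv : v ∈ D) : inner ℝ v w = 0 := by
  refine le_antisymm (hw v hv) ?_
  obtain ⟨y, hy, hy0⟩ := mem_intrinsicInterior.1 h0
  have hva : v ∈ affineSpan ℝ D := subset_affineSpan ℝ D hv
  have h0a : (0 : E) ∈ affineSpan ℝ D := hy0 ▸ y.2
  have hline : ∀ t : ℝ, t • v ∈ affineSpan ℝ D := fun t => by
    simpa [AffineMap.lineMap_apply] using AffineMap.lineMap_mem t h0a hva
  let g : ℝ → affineSpan ℝ D := fun t => ⟨t • v, hline t⟩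
  have hg : Continuous g := (continuous_id.smul continuous_const).subtype_mk _
  have hg0 : g 0 = y := Subtype.ext (by simp [g, hy0])
  have hev : ∀ᶠ t in 𝓝 (0 : ℝ), g t ∈ ((↑) ⁻¹' D : Set (affineSpan ℝ D)) := by
    refine (hg.tendsto 0).eventually ?_
    rw [hg0]
    exact mem_interior_iff_mem_nhds.1 hy
  -- Relative interiority puts some negative multiple of `v` in `D`, which reverses the inequality.
  obtain ⟨t, ht, ht0⟩ := ((hev.filter_mono nhdsWithin_le_nhds).and
    (self_mem_nhdsWithin (s := Iio (0 : ℝ)))).exists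
  have h1 : inner ℝ (t • v) w ≤ 0 := hw _ ht
  rw [real_inner_smul_left] at h1
  exact nonneg_of_mul_nonpos_right h1 ht0

theorem IsSublinear.dense_differentiableAt {m : ℕ} {h : Euc m → ℝ} (hh : IsSublinear h) :
    Dense {z | DifferentiableAt ℝ h z} := by
  obtain ⟨K, hK⟩ := hh.exists_le_norm
  exact MeasureTheory.Measure.dense_of_ae
    (hh.lipschitzWith hK).ae_differentiableAt (μ := MeasureTheory.volume)

section Decomposition

variable {d m k : ℕ} {f : Euc d → ℝ} {h : Euc m → ℝ} {c : Euc d → Euc m} {a : ℝ} {x : Euc d}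
  {Q : Euc m →L[ℝ] Euc k}

open ContinuousLinearMap (adjoint)

open scoped Pointwise in
theorem surjective_comp_of_add_range_eq_univ {A : Euc d →L[ℝ] Euc m} {L : Set (Euc m)}
    (hQ : ∀ y, Q y = 0 ↔ y ∈ L) (hQs : Function.Surjective Q)
    (hA : L + range A = univ) :
    Function.Surjective (Q ∘L A) := by
  intro z
  obtain ⟨y, rfl⟩ := hQs z
  obtain ⟨l, hl, _, ⟨w, rfl⟩, rfl⟩ := mem_add.1 (hA ▸ mem_univ y : y ∈ L + range A)
  exact ⟨w, by simp [(hQ l).2 hl]⟩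

/-- Under strict complementarity, the directions in which `h` is nonpositive are those of its
lineality space. -/
theorem mem_lineality_of_strictComplementarity (hh : IsSublinear h) (hc : ContDiff ℝ 1 c)
    (hfc : ∀ᶠ z in 𝓝 x, f z = a + h (c z)) (hQ : ∀ y, Q y = 0 ↔ y ∈ lineality h)
    (hcx : c x = 0) (hsurj : Function.Surjective (Q ∘L fderiv ℝ c x))
    (hsc : StrictComplementarity f x) {w : Euc d} (hw : h (fderiv ℝ c x w) ≤ 0) :
    fderiv ℝ c x w ∈ lineality h := by
  have hzero : ∀ v ∈ clarkeSubdifferential f x, inner ℝ v w = 0 := by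
    intro v hv
    refine inner_eq_zero_of_zero_mem_intrinsicInterior hsc (fun v hv => ?_) hv
    obtain ⟨s, hs, rfl⟩ := clarkeSubdifferential_subset hh hc hfc hv
    rw [ContinuousLinearMap.adjoint_inner_left]
    exact (hs.1 _).trans hw
  obtain ⟨K, hK⟩ := hh.exists_le_norm
  -- At a point of differentiability, orthogonality of the gradient to `∇c(x) w` gives `h z =
  -- ⟨∇h(z), z + ∇c(x) w⟩`. The resulting bound extends by density to `z = -∇c(x) w`, where its
  -- right side is zero.
  have hcl : IsClosed {z | h z ≤ K * ‖z + fderiv ℝ c x w‖} :=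
    isClosed_le hh.continuous (by fun_prop)
  have hsub : {z | DifferentiableAt ℝ h z} ⊆ {z | h z ≤ K * ‖z + fderiv ℝ c x w‖} := by
    intro z hz
    have hz' : DifferentiableAt ℝ h z := hz
    have hmem := hh.mem_sublinearSubdifferential_of_hasGradientAt hz'.hasGradientAt
    have h1 := hzero _ (adjoint_mem_clarkeSubdifferential hh hc hfc hQ hcx hsurj
      hz'.hasGradientAt)
    rw [ContinuousLinearMap.adjoint_inner_left] at h1
    have h2 := (hmem.1 (z + fderiv ℝ c x w)).trans (hK _)
    rw [inner_add_right, h1, add_zero, hmem.2] at h2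
    exact h2
  have hall : -fderiv ℝ c x w ∈ {z | h z ≤ K * ‖z + fderiv ℝ c x w‖} :=
    hcl.closure_subset_iff.2 hsub (hh.dense_differentiableAt _)
  have hneg : h (-fderiv ℝ c x w) ≤ 0 := by simpa using hall
  have := hh.neg_map_neg_le (fderiv ℝ c x w)
  change h _ = -h _
  linarith

/-- A sublinear function grows linearly transversally to its lineality space, relative to a
minorant, as soon as it is positive off the lineality space on a transversal subspace. -/
theorem IsSublinear.exists_pos_mul_norm_le (hh : IsSublinear h)
    (hQ : ∀ y, Q y = 0 ↔ y ∈ lineality h) (hQs : Function.Surjective Q)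
    {A : Euc d →L[ℝ] Euc m} (hsurj : Function.Surjective (Q ∘L A)) {s : Euc m}
    (hs : s ∈ linearMinorants h) (hsA : ∀ w, inner ℝ s (A w) = 0)
    (hpos : ∀ w, h (A w) ≤ 0 → A w ∈ lineality h) :
    ∃ ε : ℝ, 0 < ε ∧ ∀ y, ε * ‖Q y‖ ≤ h y - inner ℝ s y := by
  have hinv : ∀ y z, Q y = Q z → h y - inner ℝ s y = h z - inner ℝ s z := by
    intro y z hyz
    have hl : y - z ∈ lineality h := by rw [← hQ, map_sub, hyz, sub_self]
    have h1 := hh.map_add_of_mem_lineality z hl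
    have h2 := inner_eq_of_mem_lineality hs hl
    rw [add_sub_cancel] at h1
    rw [inner_sub_right] at h2
    linarith
  obtain ⟨R, hR⟩ := Q.exists_rightInverse_of_surjective (LinearMap.range_eq_top.2 hQs)
  have hQR : ∀ z, Q (R z) = z := fun z => DFunLike.congr_fun hR z
  -- By `hinv` the representative `R z` may be replaced by some `A w`, on which `s` vanishes and `h`
  -- is positive.
  obtain ⟨ε, hε, hmin⟩ := (isCompact_sphere (0 : Euc k) 1).exists_forall_le'
    (f := fun z => h (R z) - inner ℝ s (R z)) (a := 0)
    (by have := hh.continuous; fun_prop) (by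
      intro z hz
      obtain ⟨w, hw⟩ := hsurj z
      have hw' : Q (A w) = z := hw
      rw [hinv (R z) (A w) (by rw [hQR, hw']), hsA, sub_zero]
      by_contra hcon
      rw [(hQ _).2 (hpos w (not_lt.1 hcon))] at hw'
      simp [← hw'] at hz)
  refine ⟨ε, hε, fun y => ?_⟩
  rcases eq_or_ne (Q y) 0 with h0 | h0
  · rw [h0, norm_zero, mul_zero]
    exact sub_nonneg.2 (hs y)
  · have hpos' : 0 < ‖Q y‖ := norm_pos_iff.2 h0
    have h1 := hmin (‖Q y‖⁻¹ • Q y) (by simp [norm_smul, hpos'.ne'])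
    rw [hinv y (‖Q y‖ • R (‖Q y‖⁻¹ • Q y)) (by
      rw [_root_.map_smul, hQR, smul_inv_smul₀ hpos'.ne']), hh.map_smul hpos', real_inner_smul_right,
      ← mul_sub, mul_comm]
    exact mul_le_mul_of_nonneg_left h1 hpos'.le

/-- Sharpness: away from the active manifold, the subgradients are bounded away from zero. -/
theorem exists_pos_le_norm_of_notMem (hh : IsSublinear h) (hc : ContDiff ℝ 1 c)
    (hfc : ∀ᶠ z in 𝓝 x, f z = a + h (c z)) (hQ : ∀ y, Q y = 0 ↔ y ∈ lineality h)
    (hQs : Function.Surjective Q) (hsurj : Function.Surjective (Q ∘L fderiv ℝ c x)) {s₀ : Euc m}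
    (hs₀ : s₀ ∈ linearMinorants h) (hsA : ∀ w, inner ℝ s₀ (fderiv ℝ c x w) = 0)
    (hpos : ∀ w, h (fderiv ℝ c x w) ≤ 0 → fderiv ℝ c x w ∈ lineality h) :
    ∃ U ∈ 𝓝 x, ∃ μ : ℝ, 0 < μ ∧ ∀ z ∈ U \ c ⁻¹' lineality h,
      ∀ v ∈ clarkeSubdifferential f z, μ ≤ ‖v‖ := by
  obtain ⟨ε, hε, hgrow⟩ := hh.exists_pos_mul_norm_le hQ hQs hsurj hs₀ hsA hpos
  obtain ⟨K, hK⟩ := hh.exists_le_norm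
  obtain ⟨R, hR⟩ := Q.exists_rightInverse_of_surjective (LinearMap.range_eq_top.2 hQs)
  obtain ⟨S, hS⟩ := (Q ∘L fderiv ℝ c x).exists_rightInverse_of_surjective
    (LinearMap.range_eq_top.2 hsurj)
  have hQR : ∀ z, Q (R z) = z := fun z => DFunLike.congr_fun hR z
  have hQS : ∀ z, Q (fderiv ℝ c x (S z)) = z := fun z => DFunLike.congr_fun hS z
  have hcont : Tendsto (fun z => ‖S‖ * (K * ‖fderiv ℝ c z - fderiv ℝ c x‖)) (𝓝 x) (𝓝 0) := by
    have h1 : Continuous fun z => ‖S‖ * (K * ‖fderiv ℝ c z - fderiv ℝ c x‖) := by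
      have := hc.continuous_fderiv one_ne_zero
      fun_prop
    simpa using h1.tendsto x
  -- The estimate is `ε ≤ ‖t‖ ≤ ‖S‖ (‖v‖ + K ‖∇c(z) - ∇c(x)‖)`; the neighbourhood absorbs half of
  -- `ε`, and the `+ 1` avoids division by zero.
  refine ⟨_, inter_mem hfc.eventually_nhds (hcont.eventually_le_const (half_pos hε)),
    ε / 2 / (‖S‖ + 1), by positivity, ?_⟩
  rintro z ⟨⟨hz, hzS⟩, hzM⟩ v hv
  have hzS' : ‖S‖ * (K * ‖fderiv ℝ c z - fderiv ℝ c x‖) ≤ ε / 2 := hzS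
  obtain ⟨s, hs, rfl⟩ := clarkeSubdifferential_subset hh hc hz hv
  have hzQ : 0 < ‖Q (c z)‖ := norm_pos_iff.2 fun h0 => hzM ((hQ _).1 h0)
  -- Since `s - s₀` vanishes on `L`, it factors through `Q`, and `t` represents the factor.
  set t := adjoint R (s - s₀) with ht
  have hfac : ∀ y, inner ℝ t (Q y) = inner ℝ (s - s₀) y := by
    intro y
    have hl : y - R (Q y) ∈ lineality h := by rw [← hQ, map_sub, hQR, sub_self]
    have h1 := inner_eq_of_mem_lineality hs.1 hl
    have h2 := inner_eq_of_mem_lineality hs₀ hl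
    rw [ht, ContinuousLinearMap.adjoint_inner_left]
    rw [inner_sub_right] at h1 h2
    rw [inner_sub_left, inner_sub_left]
    linarith
  have hεt : ε ≤ ‖t‖ := by
    have h1 := hgrow (c z)
    rw [← hs.2, ← inner_sub_left, ← hfac] at h1
    exact le_of_mul_le_mul_right (h1.trans (real_inner_le_norm _ _)) hzQ
  have ht0 : 0 < ‖t‖ := hε.trans_le hεt
  have hsn := norm_le_of_mem_linearMinorants hs.1 hK
  have hSt : ‖S t‖ ≤ ‖S‖ * ‖t‖ := S.le_opNorm t
  have hsq : ‖t‖ * ‖t‖ ≤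
      (‖S‖ * (‖adjoint (fderiv ℝ c z) s‖ + K * ‖fderiv ℝ c z - fderiv ℝ c x‖)) * ‖t‖ := by
    -- Pair `t` with `Q (∇c(x) (S t)) = t`: the `s₀` term drops out by `hsA`, and `∇c(x)` is then
    -- exchanged for `∇c(z)`.
    have h1 : ‖t‖ * ‖t‖ = inner ℝ (adjoint (fderiv ℝ c z) s) (S t)
        - inner ℝ s ((fderiv ℝ c z - fderiv ℝ c x) (S t)) := by
      rw [← real_inner_self_eq_norm_mul_norm]
      nth_rewrite 2 [← hQS t]
      rw [hfac, inner_sub_left, hsA, sub_zero, ContinuousLinearMap.adjoint_inner_left,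
        ← inner_sub_right]
      simp
    have h2 := real_inner_le_norm (adjoint (fderiv ℝ c z) s) (S t)
    have h3 := (abs_le.1 (abs_real_inner_le_norm s ((fderiv ℝ c z - fderiv ℝ c x) (S t)))).1
    have h4 : ‖s‖ * ‖(fderiv ℝ c z - fderiv ℝ c x) (S t)‖
        ≤ K * (‖fderiv ℝ c z - fderiv ℝ c x‖ * ‖S t‖) :=
      mul_le_mul hsn (ContinuousLinearMap.le_opNorm _ _) (norm_nonneg _) K.2
    calc ‖t‖ * ‖t‖ ≤ (‖adjoint (fderiv ℝ c z) s‖ + K * ‖fderiv ℝ c z - fderiv ℝ c x‖) * ‖S t‖ := by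
          rw [h1]; linarith
      _ ≤ (‖adjoint (fderiv ℝ c z) s‖ + K * ‖fderiv ℝ c z - fderiv ℝ c x‖) * (‖S‖ * ‖t‖) :=
          mul_le_mul_of_nonneg_left hSt (by positivity)
      _ = _ := by ring
  have h5 := le_of_mul_le_mul_right hsq ht0
  rw [div_le_iff₀ (by positivity)]
  nlinarith [norm_nonneg (adjoint (fderiv ℝ c z) s)]

/-! ### The active manifold -/

/-- The preimage of `ker Q` under a map `c` with `Q ∘ ∇c` onto is a manifold with defining map
`Q ∘ c`. -/
theorem exists_isDefiningMap_preimage {p : ℕ} (hp : p ≠ 0) (hc : ContDiff ℝ p c) {L : Set (Euc m)}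
    (hQ : ∀ y, Q y = 0 ↔ y ∈ L) (hsurj : Function.Surjective (Q ∘L fderiv ℝ c x)) :
    ∃ U, IsDefiningMap p (c ⁻¹' L) x U (fun z => Q (c z)) := by
  have hp' : (p : WithTop ℕ∞) ≠ 0 := by exact_mod_cast hp
  obtain ⟨S, hS⟩ := (Q ∘L fderiv ℝ c x).exists_rightInverse_of_surjective
    (LinearMap.range_eq_top.2 hsurj)
  have hfd : ∀ z, fderiv ℝ (fun z => Q (c z)) z = Q ∘L fderiv ℝ c z := fun z =>
    (Q.hasFDerivAt.comp z (hc.differentiable hp' z).hasFDerivAt).fderiv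
  have hcont : Continuous fun z => (Q ∘L fderiv ℝ c z) ∘L S := by
    have := hc.continuous_fderiv hp'
    fun_prop
  -- Invertibility is an open condition, holds at `x` where the composite is the identity, and
  -- forces `Q ∘ ∇c(z)` to be onto.
  refine ⟨{z | IsUnit ((Q ∘L fderiv ℝ c z) ∘L S)}, Units.isOpen.preimage hcont, ?_,
    (Q.contDiff.comp hc).contDiffOn, fun z hz => ?_, ?_⟩
  · change IsUnit ((Q ∘L fderiv ℝ c x) ∘L S)
    rw [hS]
    exact isUnit_one
  · obtain ⟨T, hT⟩ := (show IsUnit ((Q ∘L fderiv ℝ c z) ∘L S) from hz).exists_right_inv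
    rw [hfd]
    exact fun y => ⟨S (T y), DFunLike.congr_fun hT y⟩
  · ext z
    rw [mem_inter_iff, and_comm]
    exact and_congr_right fun _ => (hQ (c z)).symm

theorem IsDefiningMap.congr_point {p : ℕ} {M U : Set (Euc d)} {F : Euc d → Euc k}
    (hF : IsDefiningMap p M x U F) {y : Euc d} (hy : y ∈ U) : IsDefiningMap p M y U F :=
  ⟨hF.isOpen, hy, hF.smooth, hF.surjective, hF.zero_set⟩

/-- On the preimage of the lineality space, `h ∘ c` agrees with a function as smooth as `c`. -/
theorem isSmoothExtension_inner {p : ℕ} (hc : ContDiff ℝ p c) {V : Set (Euc d)} (hV : IsOpen V)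
    (hfc : ∀ z ∈ V, f z = a + h (c z)) (hx : x ∈ V) {s : Euc m} (hs : s ∈ linearMinorants h) :
    IsSmoothExtension p f (c ⁻¹' lineality h) x V (fun z => a + inner ℝ s (c z)) where
  isOpen := hV
  mem := hx
  smooth := (contDiff_const.add (contDiff_const.inner ℝ hc)).contDiffOn
  agree z hz := by rw [hfc z hz.1, inner_eq_of_mem_lineality hs hz.2]

theorem gradient_add_inner_comp (hc : DifferentiableAt ℝ c x) (s : Euc m) :
    gradient (fun z => a + inner ℝ s (c z)) x = adjoint (fderiv ℝ c x) s := by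
  refine HasGradientAt.gradient ?_
  rw [hasGradientAt_iff_hasFDerivAt]
  have h1 : HasFDerivAt (fun z => a + inner ℝ s (c z)) ((innerSL ℝ s) ∘L fderiv ℝ c x) x :=
    ((innerSL ℝ s).hasFDerivAt.comp x hc.hasFDerivAt).const_add a
  have h2 : InnerProductSpace.toDual ℝ (Euc d) (adjoint (fderiv ℝ c x) s)
      = (innerSL ℝ s) ∘L fderiv ℝ c x := by
    ext w
    simp [ContinuousLinearMap.adjoint_inner_left]
  rw [h2]
  exact h1

/-! ### Regularity along the active manifold -/

/-- The constant `C` gives the linear modulus in strong `(a)`-regularity and the quadratic remainder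
in `(b_≤)`-regularity. -/
theorem exists_ball_norm_fderiv_sub_le (hc : ContDiff ℝ 2 c) (x : Euc d) :
    ∃ (C : NNReal) (r : ℝ), 0 < r ∧ ∀ y ∈ Metric.ball x r, ∀ z ∈ Metric.ball x r,
      ‖fderiv ℝ c y - fderiv ℝ c z‖ ≤ C * ‖y - z‖ := by
  have h1 : ContDiff ℝ 1 (fderiv ℝ c) := hc.fderiv_right (by norm_num)
  obtain ⟨C, t, ht, hL⟩ := h1.contDiffAt.exists_lipschitzOnWith (x := x)
  obtain ⟨r, hr, hrt⟩ := Metric.mem_nhds_iff.1 ht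
  refine ⟨C, r, hr, fun y hy z hz => ?_⟩
  simpa [dist_eq_norm] using hL.dist_le_mul y (hrt hy) z (hrt hz)

theorem strongA_of_decomposition (hh : IsSublinear h) (hc : ContDiff ℝ 2 c)
    (hfc : ∀ᶠ z in 𝓝 x, f z = a + h (c z)) (hQ : ∀ y, Q y = 0 ↔ y ∈ lineality h)
    (hsurj : Function.Surjective (Q ∘L fderiv ℝ c x)) {s₀ : Euc m}
    (hs₀ : s₀ ∈ linearMinorants h) : StrongA f x (c ⁻¹' lineality h) := by
  have hc1 : ContDiff ℝ ((1 : ℕ) : WithTop ℕ∞) c := hc.of_le (by norm_num)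
  have hcd : Differentiable ℝ c := hc.differentiable two_ne_zero
  obtain ⟨U, hU⟩ := exists_isDefiningMap_preimage one_ne_zero hc1 hQ hsurj
  obtain ⟨K, hK⟩ := hh.exists_le_norm
  obtain ⟨C, r, hr, hC⟩ := exists_ball_norm_fderiv_sub_le hc x
  obtain ⟨V, hVfc, hVo, hxV⟩ := eventually_nhds_iff.1 hfc
  refine ⟨K * C + 1, by positivity, V ∩ Metric.ball x r ∩ U,
    inter_mem (inter_mem (hVo.mem_nhds hxV) (Metric.ball_mem_nhds x hr))
      (hU.isOpen.mem_nhds hU.mem), ?_⟩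
  rintro z ⟨⟨hzV, hzr⟩, -⟩ v hv y ⟨hyM, ⟨hyV, hyr⟩, hyU⟩
  obtain ⟨s, hs, rfl⟩ := clarkeSubdifferential_subset hh (hc.of_le (by norm_num))
    (eventually_of_mem (hVo.mem_nhds hzV) hVfc) hv
  have hF := hU.congr_point hyU
  rw [covariantGradient_eq ⟨_, _, _, hF⟩ hyM (isSmoothExtension_inner hc1 hVo hVfc hyV hs₀),
    gradient_add_inner_comp (hcd y)]
  set T := tangentSpace (c ⁻¹' lineality h) y with hT
  set g := adjoint (fderiv ℝ c y) s₀
  set v := adjoint (fderiv ℝ c z) s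
  have hproj : T.starProjection (v - T.starProjection g) = T.starProjection (v - g) := by
    rw [map_sub, map_sub,
      Submodule.starProjection_eq_self_iff.2 (Submodule.starProjection_apply_mem T g)]
  rw [hproj]
  set q := T.starProjection (v - g)
  have hqT : q ∈ T := Submodule.starProjection_apply_mem T _
  have hql : fderiv ℝ c y q ∈ lineality h := by
    have hfd : fderiv ℝ (fun z => Q (c z)) y = Q ∘L fderiv ℝ c y :=
      (Q.hasFDerivAt.comp y (hcd y).hasFDerivAt).fderiv
    rw [hT, tangentSpace_eq hF hyM, hfd] at hqT
    exact (hQ _).1 hqT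
  -- Since `∇c(y) q ∈ L`, the minorant `s₀` may be replaced by `s` there.
  have hsq : ‖q‖ * ‖q‖ = inner ℝ s ((fderiv ℝ c z - fderiv ℝ c y) q) := by
    have h1 : inner ℝ (v - g) q = inner ℝ q q := by
      rw [← sub_eq_zero, ← inner_sub_left]
      exact Submodule.starProjection_inner_eq_zero _ q hqT
    rw [← real_inner_self_eq_norm_mul_norm, ← h1, inner_sub_left,
      ContinuousLinearMap.adjoint_inner_left, ContinuousLinearMap.adjoint_inner_left,
      inner_eq_of_mem_lineality hs₀ hql, ← inner_eq_of_mem_lineality hs.1 hql, ← inner_sub_right]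
    rfl
  have hle : ‖q‖ * ‖q‖ ≤ (K * (C * ‖z - y‖)) * ‖q‖ := by
    rw [hsq]
    calc inner ℝ s ((fderiv ℝ c z - fderiv ℝ c y) q)
        ≤ ‖s‖ * ‖(fderiv ℝ c z - fderiv ℝ c y) q‖ := real_inner_le_norm _ _
      _ ≤ K * (C * ‖z - y‖ * ‖q‖) := mul_le_mul (norm_le_of_mem_linearMinorants hs.1 hK)
          (((fderiv ℝ c z - fderiv ℝ c y).le_opNorm q).trans
            (mul_le_mul_of_nonneg_right (hC z hzr y hyr) (norm_nonneg q)))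
          (norm_nonneg _) K.2
      _ = _ := by ring
  have hqle : ‖q‖ ≤ K * (C * ‖z - y‖) := by
    rcases (norm_nonneg q).eq_or_lt with h0 | h0
    · rw [← h0]
      positivity
    · exact le_of_mul_le_mul_right hle h0
  linarith [norm_nonneg (z - y)]

/-- The multiplier `s` satisfies `h (c y) ≥ ⟨s, c y⟩` with equality at `z`; linearizing `c` at `z`
costs at most `K C ‖y - z‖ ^ 2`. -/
theorem bLeRegular_of_decomposition (hh : IsSublinear h) (hc : ContDiff ℝ 2 c)
    (hfc : ∀ᶠ z in 𝓝 x, f z = a + h (c z)) (M : Set (Euc d)) : BLeRegular f x M := by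
  obtain ⟨K, hK⟩ := hh.exists_le_norm
  obtain ⟨C, r, hr, hC⟩ := exists_ball_norm_fderiv_sub_le hc x
  obtain ⟨V, hVfc, hVo, hxV⟩ := eventually_nhds_iff.1 hfc
  refine ⟨fun t => -(K * C) * t ^ 2, ?_, V ∩ Metric.ball x r,
    inter_mem (hVo.mem_nhds hxV) (Metric.ball_mem_nhds x hr), ?_⟩
  · have h1 : Tendsto (fun t : ℝ => -(K * C : ℝ) * t) (𝓝[≠] 0) (𝓝 0) := by
      have h2 : Continuous fun t : ℝ => -(K * C : ℝ) * t := by fun_prop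
      simpa using (h2.tendsto 0).mono_left nhdsWithin_le_nhds
    refine h1.congr' ?_
    filter_upwards [self_mem_nhdsWithin] with t ht
    have ht' : t ≠ 0 := ht
    field_simp
  · rintro z ⟨hzV, hzr⟩ v hv y ⟨-, hyV, hyr⟩
    obtain ⟨s, hs, rfl⟩ := clarkeSubdifferential_subset hh (hc.of_le (by norm_num))
      (eventually_of_mem (hVo.mem_nhds hzV) hVfc) hv
    have hseg : segment ℝ z y ⊆ Metric.ball x r := (convex_ball x r).segment_subset hzr hyr
    have htaylor : ‖c y - c z - fderiv ℝ c z (y - z)‖ ≤ C * ‖y - z‖ * ‖y - z‖ := by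
      refine (convex_segment z y).norm_image_sub_le_of_norm_fderiv_le' (𝕜 := ℝ)
        (fun w _ => hc.differentiable two_ne_zero w) (fun w hw => ?_)
        (left_mem_segment ℝ z y) (right_mem_segment ℝ z y)
      refine (hC w (hseg hw) z hzr).trans (mul_le_mul_of_nonneg_left ?_ C.2)
      exact norm_sub_le_of_mem_segment hw
    have h1 := (abs_le.1 (abs_real_inner_le_norm s (c y - c z - fderiv ℝ c z (y - z)))).1
    have h2 : ‖s‖ * ‖c y - c z - fderiv ℝ c z (y - z)‖ ≤ K * (C * ‖y - z‖ * ‖y - z‖) :=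
      mul_le_mul (norm_le_of_mem_linearMinorants hs.1 hK) htaylor (norm_nonneg _) K.2
    have h3 := hs.1 (c y)
    rw [inner_sub_right, inner_sub_right, hs.2] at h1
    rw [hVfc y hyV, hVfc z hzV, ContinuousLinearMap.adjoint_inner_left]
    linarith [show (K : ℝ) * (C * ‖y - z‖ * ‖y - z‖) = K * C * ‖y - z‖ ^ 2 by ring]

end Decomposition

end NonsmoothOpt

/-! ### Verification of Assumption A. -/

theorem mainTheorem5 {d m : ℕ} (f : NonsmoothOpt.Euc d → ℝ) (xbar : NonsmoothOpt.Euc d)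
    (h : NonsmoothOpt.Euc m → ℝ) (c : NonsmoothOpt.Euc d → NonsmoothOpt.Euc m)
    (hLip : LocallyLipschitz f) (hmin : IsLocalMin f xbar)
    (hdec : NonsmoothOpt.IsProperlyDecomposableAs 4 f xbar h c)
    (hsc : NonsmoothOpt.StrictComplementarity f xbar)
    (hgrowth : NonsmoothOpt.QuadraticGrowth f xbar) :
    NonsmoothOpt.AssumptionA f xbar (c ⁻¹' NonsmoothOpt.lineality h) := by
  have hh := hdec.sublinear
  have hfc := hdec.decomp
  have hc1 : ContDiff ℝ 1 c := hdec.smooth.of_le (by norm_num)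
  have hc2 : ContDiff ℝ 2 c := hdec.smooth.of_le (by norm_num)
  obtain ⟨k, Q, hQs, hQ⟩ := hh.exists_ker_eq_lineality
  have hsurj := NonsmoothOpt.surjective_comp_of_add_range_eq_univ hQ hQs hdec.transversality
  have hcrit : (0 : NonsmoothOpt.Euc d) ∈ NonsmoothOpt.clarkeSubdifferential f xbar :=
    intrinsicInterior_subset hsc
  -- The multiplier of the critical point: it defines the smooth extension of `f` off `M` and is the
  -- reference minorant for sharpness.
  obtain ⟨s, hs, hs0⟩ := NonsmoothOpt.clarkeSubdifferential_subset hh hc1 hfc hcrit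
  have hsA : ∀ w, inner ℝ s (fderiv ℝ c xbar w) = 0 := fun w => by
    rw [← ContinuousLinearMap.adjoint_inner_left, hs0, inner_zero_left]
  obtain ⟨V, hVfc, hVo, hxV⟩ := eventually_nhds_iff.1 hfc
  obtain ⟨U, hU⟩ := NonsmoothOpt.exists_isDefiningMap_preimage four_ne_zero hdec.smooth hQ hsurj
  refine ⟨hLip, hmin, hgrowth, ⟨?_, hcrit, ⟨k, U, _, hU⟩,
    ⟨V, _, NonsmoothOpt.isSmoothExtension_inner hdec.smooth hVo hVfc hxV hs.1⟩, ?_⟩, ?_, ?_⟩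
  · rw [mem_preimage, hdec.map_base]
    exact hh.linealitySubmodule.zero_mem
  · exact NonsmoothOpt.exists_pos_le_norm_of_notMem hh hc1 hfc hQ hQs hsurj hs.1 hsA fun w hw =>
      NonsmoothOpt.mem_lineality_of_strictComplementarity hh hc1 hfc hQ hdec.map_base hsurj hsc hw
  · exact NonsmoothOpt.strongA_of_decomposition hh hc2 hfc hQ hsurj hs.1
  · exact NonsmoothOpt.bLeRegular_of_decomposition hh hc2 hfc _
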